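/- Let $\mathcal X$ be a separable topological space whose $\sigma$-algebra contains the open sets, let $k\colon\mathcal X\times\mathcal X\to\mathbb R$ be a continuous and uniformly bounded kernel (symmetric and positive semidefinite), and let $(\mathcal H_k,\|\cdot\|_k)$ be its reproducing kernel Hilbert space. Let $\rho$ be a probability measure on $\mathcal X\times\mathbb R$, let $(X,f)$ have law $\rho$ with $\mathbb E f^2<\infty$, and let $(X_1,f_1),(X_2,f_2),\dots$ be independent samples from $\rho$. Fix $\lambda>0$ and define the optimal value of the continuous problem and the SAA estimators $$\vartheta^*=\min_{g\in\mathcal H_k}\ \mathbb E\big(f-g(X)\big)^2+\lambda\|g\|_k^2,\qquad \hat\vartheta_n=\min_{g\in\mathcal H_k}\ \frac1n\sum_{i=1}^n\big(f_i-g(X_i)\big)^2+\lambda\|g\|_k^2 .$$ Then every $\hat\vartheta_n$ is integrable and $\mathbb E|\hat\vartheta_n-\vartheta^*|\to0$ as $n\to\infty$. If moreover $\mathbb E f^4<\infty$, then the estimators $\hat\vartheta_n$ are $L^2$-consistent for $\vartheta^*$: every $\hat\vartheta_n$ is square integrable and $$\mathbb E\big(\hat\vartheta_n-\vartheta^*\big)^2\to0\qquad(n\to\infty).$$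 -/

import Mathlib

open MeasureTheory ProbabilityTheory Filter Topology

noncomputable section

/-- The objective `E (f - g(X))² + lam ‖g‖²` of the continuous problem at a function `g` of the
reproducing kernel Hilbert space `H`, where the pair `(X, f)` has law `ρ` on `X × ℝ`. -/
def continuousObjective {X H : Type*} [MeasurableSpace X]
    [NormedAddCommGroup H] [InnerProductSpace ℝ H] [RKHS ℝ H X ℝ]
    (ρ : Measure (X × ℝ)) (lam : ℝ) (g : H) : ℝ :=
  (∫ z, (z.2 - g z.1) ^ 2 ∂ρ) + lam * ‖g‖ ^ 2

/-- The optimal value `ϑ*` of the continuous problem over `H`. -/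
def optimalValue {X : Type*} (H : Type*) [MeasurableSpace X]
    [NormedAddCommGroup H] [InnerProductSpace ℝ H] [RKHS ℝ H X ℝ]
    (ρ : Measure (X × ℝ)) (lam : ℝ) : ℝ :=
  ⨅ g : H, continuousObjective ρ lam g

/-- The sample average objective `(1/n) ∑ (fᵢ - g(Xᵢ))² + lam ‖g‖²` at `g`, for the first `n`
data points `z i = (Xᵢ, fᵢ)`. -/
def empiricalObjective {X H : Type*}
    [NormedAddCommGroup H] [InnerProductSpace ℝ H] [RKHS ℝ H X ℝ]
    (n : ℕ) (z : ℕ → X × ℝ) (lam : ℝ) (g : H) : ℝ :=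
  (1 / (n : ℝ)) * ∑ i ∈ Finset.range n, ((z i).2 - g (z i).1) ^ 2 + lam * ‖g‖ ^ 2

/-- The SAA estimator of the optimal value for the data `z`: the minimum over `H` of the sample
average objective. -/
def saaValue {X : Type*} (H : Type*)
    [NormedAddCommGroup H] [InnerProductSpace ℝ H] [RKHS ℝ H X ℝ]
    (n : ℕ) (z : ℕ → X × ℝ) (lam : ℝ) : ℝ :=
  ⨅ g : H, empiricalObjective n z lam g

end

open MeasureTheory ProbabilityTheory Filter Topology

noncomputable section

/-! With the feature map `φ x = k(x, ·)`, the loss `(f - ⟪g, φ X⟫)²` is linear in the moments `(f²,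
f φ X, φ X ⊗ φ X)`. Both optimal values are therefore the same functional, an infimum over `g`,
evaluated at the empirical and at the true mean of these moments. The Banach-valued strong law gives
almost sure convergence of the means. The functional is continuous along them because only a fixed
ball of `g` matters (`tendsto_iInf_momentObjective`), so the estimators converge almost surely.
Testing `g = 0` bounds each estimator by the empirical mean of `f²`. That mean converges in `Lᵖ`
when `f² ∈ Lᵖ`, hence is uniformly `p`-integrable, and Vitali's theorem upgrades the convergence to
`Lᵖ`. The cases `p = 1` and `p = 2` give the theorem. -/

/-- A pointwise infimum of uniformly Lipschitz functions is Lipschitz. -/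
theorem LipschitzWith.ciInf_of_bddBelow {α ι : Type*} [PseudoMetricSpace α] [Nonempty ι]
    {K : NNReal} {F : ι → α → ℝ} (hF : ∀ i, LipschitzWith K (F i))
    (hbdd : ∀ a, BddBelow (Set.range fun i => F i a)) :
    LipschitzWith K fun a => ⨅ i, F i a := by
  refine LipschitzWith.of_le_add_mul K fun a b => ?_
  rw [← sub_le_iff_le_add]
  refine le_ciInf fun i => ?_
  rw [sub_le_iff_le_add]
  exact (ciInf_le (hbdd a) i).trans ((hF i).le_add_mul a b)

/-- A continuous function on a separable space is strongly measurable. -/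
theorem Continuous.stronglyMeasurable_of_separableSpace {α β : Type*} [TopologicalSpace α]
    [TopologicalSpace.SeparableSpace α] [MeasurableSpace α] [OpensMeasurableSpace α]
    [TopologicalSpace β] [TopologicalSpace.PseudoMetrizableSpace β] {f : α → β}
    (hf : Continuous f) : StronglyMeasurable f := by
  borelize β
  exact stronglyMeasurable_iff_measurable_separable.2
    ⟨hf.measurable, TopologicalSpace.isSeparable_range hf⟩

/-! ### The feature map of the kernel -/

section FeatureMap

variable {X : Type*} (H : Type*) [NormedAddCommGroup H] [InnerProductSpace ℝ H] [CompleteSpace H]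
  [RKHS ℝ H X ℝ]

/-- The canonical feature map, sending `x` to the representer of the evaluation at `x`. -/
def featureMap (x : X) : H := RKHS.kerFun H x (1 : ℝ)

variable {H} in
@[simp]
theorem inner_featureMap (x : X) (g : H) : inner ℝ g (featureMap H x) = g x := by
  simp [featureMap]

variable {H} in
@[simp]
theorem featureMap_inner (x : X) (g : H) : inner ℝ (featureMap H x) g = g x := by
  simp [featureMap]

theorem inner_featureMap_featureMap {k : X → X → ℝ} (hH : ∀ x y, RKHS.kernel H x y 1 = k x y)
    (x y : X) : inner ℝ (featureMap H x) (featureMap H y) = k x y := by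
  rw [featureMap_inner, featureMap, RKHS.kerFun_apply, hH]

theorem norm_featureMap_sq {k : X → X → ℝ} (hH : ∀ x y, RKHS.kernel H x y 1 = k x y) (x : X) :
    ‖featureMap H x‖ ^ 2 = k x x := by
  rw [← real_inner_self_eq_norm_sq, inner_featureMap_featureMap H hH]

theorem norm_featureMap_sub_sq {k : X → X → ℝ} (hH : ∀ x y, RKHS.kernel H x y 1 = k x y)
    (x y : X) : ‖featureMap H x - featureMap H y‖ ^ 2 = k x x - 2 * k x y + k y y := by
  rw [norm_sub_sq_real, norm_featureMap_sq H hH, norm_featureMap_sq H hH,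
    inner_featureMap_featureMap H hH]

/-- By the reproducing property the squared distance of two features is `k x x - 2 * k x y + k y y`,
which is continuous in `x` and vanishes at `x = y`. -/
theorem continuous_featureMap [TopologicalSpace X] {k : X → X → ℝ}
    (hk : Continuous fun p : X × X => k p.1 p.2) (hH : ∀ x y, RKHS.kernel H x y 1 = k x y) :
    Continuous (featureMap H : X → H) := by
  rw [continuous_iff_continuousAt]
  intro y
  refine tendsto_iff_norm_sub_tendsto_zero.2 ?_
  have hxx : Continuous fun x : X => k x x := hk.comp (by fun_prop : Continuous fun x : X => (x, x))
  have hxy : Continuous fun x : X => k x y := hk.comp (by fun_prop : Continuous fun x : X => (x, y))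
  have hc : Continuous fun x : X => √(k x x - 2 * k x y + k y y) := by fun_prop
  have hlim := hc.tendsto y
  simp only [← norm_featureMap_sub_sq H hH, Real.sqrt_sq (norm_nonneg _)] at hlim
  rwa [sub_self, norm_zero] at hlim

theorem exists_norm_featureMap_le {k : X → X → ℝ} (hk : ∃ C : ℝ, ∀ x y, |k x y| ≤ C)
    (hH : ∀ x y, RKHS.kernel H x y 1 = k x y) :
    ∃ C : ℝ, ∀ x : X, ‖featureMap H x‖ ≤ C := by
  obtain ⟨C, hC⟩ := hk
  refine ⟨√C, fun x => Real.le_sqrt_of_sq_le ?_⟩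
  rw [norm_featureMap_sq H hH]
  exact (le_abs_self _).trans (hC x x)

end FeatureMap

theorem continuous_rankOne_self {H : Type*} [NormedAddCommGroup H] [InnerProductSpace ℝ H] :
    Continuous fun x : H => InnerProductSpace.rankOne ℝ x x :=
  (InnerProductSpace.rankOne (E := H) (F := H) ℝ).continuous.clm_apply continuous_id

/-! ### The optimal value as a function of the moments -/

section Moments

/-- The space of the moments on which the quadratic objective depends: the second moment of the
response, its cross moment with the features, and the second moment operator of the features. -/
abbrev LossMoments (H : Type*) [NormedAddCommGroup H] [InnerProductSpace ℝ H] : Type _ :=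
  ℝ × H × (H →L[ℝ] H)

variable {H : Type*} [NormedAddCommGroup H] [InnerProductSpace ℝ H]

/-- The mean squared loss of `g` as a continuous linear function of the moments. -/
def momentLoss (g : H) : LossMoments H →L[ℝ] ℝ :=
  ContinuousLinearMap.fst ℝ _ _
    - (2 : ℝ) • (innerSL ℝ g).comp
        ((ContinuousLinearMap.fst ℝ _ _).comp (ContinuousLinearMap.snd ℝ _ _))
    + ((innerSL ℝ g).comp (ContinuousLinearMap.apply ℝ H g)).comp
        ((ContinuousLinearMap.snd ℝ _ _).comp (ContinuousLinearMap.snd ℝ _ _))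

theorem momentLoss_apply (g : H) (u : LossMoments H) :
    momentLoss g u = u.1 - 2 * inner ℝ g u.2.1 + inner ℝ g (u.2.2 g) := by
  simp [momentLoss]

theorem norm_momentLoss_le {g : H} {R : ℝ} (hg : ‖g‖ ≤ R) :
    ‖momentLoss g‖ ≤ 1 + 2 * R + R ^ 2 := by
  have hR : 0 ≤ R := (norm_nonneg g).trans hg
  refine ContinuousLinearMap.opNorm_le_bound _ (by positivity) fun u => ?_
  rw [momentLoss_apply]
  have h1 : ‖u.1‖ ≤ ‖u‖ := norm_fst_le u
  have h2 : ‖u.2.1‖ ≤ ‖u‖ := (norm_fst_le u.2).trans (norm_snd_le u)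
  have h3 : ‖u.2.2‖ ≤ ‖u‖ := (norm_snd_le u.2).trans (norm_snd_le u)
  have h4 : ‖(inner ℝ g u.2.1 : ℝ)‖ ≤ R * ‖u‖ := (norm_inner_le_norm _ _).trans (by gcongr)
  have h5 : ‖(inner ℝ g (u.2.2 g) : ℝ)‖ ≤ R * (‖u‖ * R) :=
    (norm_inner_le_norm _ _).trans (by gcongr; exact (u.2.2.le_opNorm g).trans (by gcongr))
  calc ‖u.1 - 2 * inner ℝ g u.2.1 + inner ℝ g (u.2.2 g)‖
      ≤ ‖u.1‖ + ‖2 * (inner ℝ g u.2.1 : ℝ)‖ + ‖(inner ℝ g (u.2.2 g) : ℝ)‖ :=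
        (norm_add_le _ _).trans (by gcongr; exact norm_sub_le _ _)
    _ = ‖u.1‖ + 2 * ‖(inner ℝ g u.2.1 : ℝ)‖ + ‖(inner ℝ g (u.2.2 g) : ℝ)‖ := by simp
    _ ≤ ‖u‖ + 2 * (R * ‖u‖) + R * (‖u‖ * R) := by gcongr
    _ = (1 + 2 * R + R ^ 2) * ‖u‖ := by ring

/-- The regularized objective at `g` in terms of the moments. -/
def momentObjective (lam : ℝ) (u : LossMoments H) (g : H) : ℝ :=
  momentLoss g u + lam * ‖g‖ ^ 2

theorem momentObjective_zero (lam : ℝ) (u : LossMoments H) : momentObjective lam u 0 = u.1 := by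
  simp [momentObjective, momentLoss_apply]

/-- The minimum of the regularized objective over a closed ball. -/
def ballValue (lam R : ℝ) (u : LossMoments H) : ℝ :=
  ⨅ g : Metric.closedBall (0 : H) R, momentObjective lam u g

/-- The Lipschitz constant of the loss in the moments grows quadratically with `‖g‖`; on a ball it
is uniform and survives the infimum. -/
theorem continuous_ballValue {lam R : ℝ} (hlam : 0 ≤ lam) (hR : 0 ≤ R) :
    Continuous (ballValue lam R : LossMoments H → ℝ) := by
  have hne : Nonempty (Metric.closedBall (0 : H) R) := ⟨⟨0, by simpa using hR⟩⟩
  have hnorm : ∀ g : Metric.closedBall (0 : H) R,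
      ‖momentLoss (g : H)‖ ≤ 1 + 2 * R + R ^ 2 := fun g =>
    norm_momentLoss_le (mem_closedBall_zero_iff.1 g.2)
  refine (LipschitzWith.ciInf_of_bddBelow (K := (1 + 2 * R + R ^ 2).toNNReal)
    (fun g => ?_) fun u => ?_).continuous
  · refine LipschitzWith.of_dist_le_mul fun u v => ?_
    rw [Real.coe_toNNReal _ (by positivity), dist_eq_norm, dist_eq_norm, momentObjective,
      momentObjective, add_sub_add_right_eq_sub, ← map_sub]
    exact (momentLoss (g : H)).le_of_opNorm_le (hnorm g) _
  · refine ⟨-((1 + 2 * R + R ^ 2) * ‖u‖), ?_⟩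
    rintro _ ⟨g, rfl⟩
    have h := neg_le_of_abs_le ((momentLoss (g : H)).le_of_opNorm_le (hnorm g) u)
    have : 0 ≤ lam * ‖(g : H)‖ ^ 2 := by positivity
    simp only [momentObjective]
    linarith

/-- If the loss is nonnegative, large balls contain all relevant candidates. -/
theorem iInf_momentObjective_eq_ballValue {lam R : ℝ} (hlam : 0 < lam) (hR : 0 ≤ R)
    {u : LossMoments H} (hu : ∀ g, 0 ≤ momentLoss g u) (huR : u.1 ≤ lam * R ^ 2) :
    ⨅ g, momentObjective lam u g = ballValue lam R u := by
  have hnn : ∀ g, 0 ≤ momentObjective lam u g := fun g =>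
    add_nonneg (hu g) (by positivity)
  have hne : Nonempty (Metric.closedBall (0 : H) R) := ⟨⟨0, by simpa using hR⟩⟩
  have hbdd : BddBelow (Set.range fun g : Metric.closedBall (0 : H) R =>
      momentObjective lam u (g : H)) := ⟨0, by rintro _ ⟨g, rfl⟩; exact hnn g⟩
  refine le_antisymm (le_ciInf fun g => ciInf_le ⟨0, ?_⟩ (g : H)) (le_ciInf fun g => ?_)
  · rintro _ ⟨g, rfl⟩
    exact hnn g
  · by_cases hg : ‖g‖ ≤ R
    · exact ciInf_le hbdd ⟨g, by simpa using hg⟩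
    -- Outside the ball the penalty alone exceeds `lam * R ^ 2 ≥ u.1`, the objective at `0`.
    · refine (ciInf_le hbdd ⟨0, by simpa using hR⟩).trans ?_
      rw [momentObjective_zero]
      have : lam * R ^ 2 ≤ lam * ‖g‖ ^ 2 := by gcongr; exact (not_le.1 hg).le
      have := hu g
      simp only [momentObjective]
      linarith

theorem iInf_momentObjective_nonneg {lam : ℝ} (hlam : 0 ≤ lam)
    {u : LossMoments H} (hu : ∀ g, 0 ≤ momentLoss g u) :
    0 ≤ ⨅ g, momentObjective lam u g :=
  Real.iInf_nonneg fun g => add_nonneg (hu g) (by positivity)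

theorem iInf_momentObjective_le {lam : ℝ} (hlam : 0 ≤ lam)
    {u : LossMoments H} (hu : ∀ g, 0 ≤ momentLoss g u) :
    ⨅ g, momentObjective lam u g ≤ u.1 := by
  rw [← momentObjective_zero lam u]
  refine ciInf_le ⟨0, ?_⟩ (0 : H)
  rintro _ ⟨g, rfl⟩
  exact add_nonneg (hu g) (by positivity)

/-- The optimal value depends continuously on the moments. -/
theorem tendsto_iInf_momentObjective {lam : ℝ} (hlam : 0 < lam) {u : ℕ → LossMoments H}
    {v : LossMoments H} (hu : ∀ n g, 0 ≤ momentLoss g (u n)) (hv : ∀ g, 0 ≤ momentLoss g v)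
    (huv : Tendsto u atTop (𝓝 v)) :
    Tendsto (fun n => ⨅ g, momentObjective lam (u n) g) atTop
      (𝓝 (⨅ g, momentObjective lam v g)) := by
  have hv0 : 0 ≤ v.1 := by simpa [momentLoss_apply] using hv 0
  -- The slack `1` makes the same radius serve all late `u n`, whose first moments converge to
  -- `v.1`.
  set R := √((v.1 + 1) / lam)
  have hR : lam * R ^ 2 = v.1 + 1 := by
    rw [Real.sq_sqrt (by positivity)]
    field_simp
  have hR0 : 0 ≤ R := Real.sqrt_nonneg _
  rw [iInf_momentObjective_eq_ballValue hlam hR0 hv (by linarith)]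
  refine (((continuous_ballValue hlam.le hR0).tendsto v).comp huv).congr' ?_
  have h1 : Tendsto (fun n => (u n).1) atTop (𝓝 v.1) := (continuous_fst.tendsto v).comp huv
  filter_upwards [h1.eventually_lt_const (lt_add_one v.1)] with n hn
  exact (iInf_momentObjective_eq_ballValue hlam hR0 (hu n) (by linarith)).symm

/-- For each `ω` the infimum equals the ball value for all large integer radii, so it is a pointwise
limit of continuous functions of the moments. -/
theorem aestronglyMeasurable_iInf_momentObjective {Ω : Type*} [MeasurableSpace Ω] {μ : Measure Ω}
    {lam : ℝ} (hlam : 0 < lam) {u : Ω → LossMoments H} (hu : ∀ ω g, 0 ≤ momentLoss g (u ω))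
    (hmeas : AEStronglyMeasurable u μ) :
    AEStronglyMeasurable (fun ω => ⨅ g, momentObjective lam (u ω) g) μ := by
  refine aestronglyMeasurable_of_tendsto_ae (u := atTop)
    (f := fun (N : ℕ) ω => ballValue lam (N : ℝ) (u ω))
    (fun N => (continuous_ballValue hlam.le N.cast_nonneg).comp_aestronglyMeasurable hmeas)
    (ae_of_all _ fun ω => tendsto_const_nhds.congr' ?_)
  have hlim : Tendsto (fun N : ℕ => lam * (N : ℝ) ^ 2) atTop atTop :=
    ((tendsto_pow_atTop two_ne_zero).comp tendsto_natCast_atTop_atTop).const_mul_atTop hlam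
  filter_upwards [hlim.eventually_ge_atTop (u ω).1] with N hN
  exact iInf_momentObjective_eq_ballValue hlam N.cast_nonneg (hu ω) hN

end Moments

/-! ### Moments of the data and of the law -/

section Data

variable {X : Type*} (H : Type*) [NormedAddCommGroup H] [InnerProductSpace ℝ H] [CompleteSpace H]
  [RKHS ℝ H X ℝ]

/-- The moments of a single data point. -/
def pointMoments (z : X × ℝ) : LossMoments H :=
  (z.2 ^ 2, z.2 • featureMap H z.1,
    InnerProductSpace.rankOne ℝ (featureMap H z.1) (featureMap H z.1))

variable {H} in
theorem momentLoss_pointMoments (g : H) (z : X × ℝ) :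
    momentLoss g (pointMoments H z) = (z.2 - g z.1) ^ 2 := by
  simp only [momentLoss_apply, pointMoments, InnerProductSpace.rankOne_apply,
    inner_smul_right, inner_featureMap, featureMap_inner]
  ring

/-- The moments of the empirical distribution of the first `n` data points. -/
def empiricalMoments (n : ℕ) (z : ℕ → X × ℝ) : LossMoments H :=
  (n : ℝ)⁻¹ • ∑ i ∈ Finset.range n, pointMoments H (z i)

variable {H} in
theorem momentLoss_empiricalMoments (n : ℕ) (z : ℕ → X × ℝ) (g : H) :
    momentLoss g (empiricalMoments H n z) =
      (1 / (n : ℝ)) * ∑ i ∈ Finset.range n, ((z i).2 - g (z i).1) ^ 2 := by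
  simp only [empiricalMoments, map_smul, map_sum, momentLoss_pointMoments, smul_eq_mul, one_div]

theorem saaValue_eq (n : ℕ) (z : ℕ → X × ℝ) (lam : ℝ) :
    saaValue H n z lam = ⨅ g, momentObjective lam (empiricalMoments H n z) g := by
  simp only [saaValue, empiricalObjective, momentObjective, momentLoss_empiricalMoments]

variable {H} in
-- This includes `n = 0`, where `0⁻¹ = 0` makes all empirical moments vanish.
theorem momentLoss_empiricalMoments_nonneg (n : ℕ) (z : ℕ → X × ℝ) (g : H) :
    0 ≤ momentLoss g (empiricalMoments H n z) := by
  rw [momentLoss_empiricalMoments]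
  positivity

theorem empiricalMoments_fst (n : ℕ) (z : ℕ → X × ℝ) :
    (empiricalMoments H n z).1 = (n : ℝ)⁻¹ • ∑ i ∈ Finset.range n, (z i).2 ^ 2 := by
  simp [empiricalMoments, pointMoments, Prod.fst_sum]

variable [MeasurableSpace X]

variable {H} in
theorem momentLoss_integral_pointMoments {ρ : Measure (X × ℝ)}
    (hint : Integrable (pointMoments H) ρ) (g : H) :
    momentLoss g (∫ z, pointMoments H z ∂ρ) = ∫ z, (z.2 - g z.1) ^ 2 ∂ρ := by
  rw [← ContinuousLinearMap.integral_comp_comm _ hint]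
  simp only [momentLoss_pointMoments]

theorem optimalValue_eq {ρ : Measure (X × ℝ)}
    (hint : Integrable (pointMoments H) ρ) (lam : ℝ) :
    optimalValue H ρ lam = ⨅ g, momentObjective lam (∫ z, pointMoments H z ∂ρ) g := by
  simp only [optimalValue, continuousObjective, momentObjective,
    momentLoss_integral_pointMoments hint]

/-- Separability of `X` enters here: features and their rank-one operators have separable range,
although the operator space need not be separable. -/
theorem stronglyMeasurable_pointMoments [TopologicalSpace X] [TopologicalSpace.SeparableSpace X]
    [OpensMeasurableSpace X] (hcont : Continuous (featureMap H : X → H)) :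
    StronglyMeasurable (pointMoments H : X × ℝ → LossMoments H) := by
  have h1 : StronglyMeasurable fun z : X × ℝ => featureMap H z.1 :=
    hcont.stronglyMeasurable_of_separableSpace.comp_measurable measurable_fst
  have h2 : StronglyMeasurable fun z : X × ℝ => z.2 := measurable_snd.stronglyMeasurable
  have h3 : StronglyMeasurable fun z : X × ℝ =>
      InnerProductSpace.rankOne ℝ (featureMap H z.1) (featureMap H z.1) :=
    continuous_rankOne_self.comp_stronglyMeasurable h1
  exact (h2.pow 2).prodMk ((h2.smul h1).prodMk h3)

/-- With bounded features the three components are at most `f²`, `C |f|` and `C²`; the product norm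
is their maximum, bounded by the sum. -/
theorem integrable_pointMoments {ρ : Measure (X × ℝ)} [IsFiniteMeasure ρ]
    (hmeas : StronglyMeasurable (pointMoments H : X × ℝ → LossMoments H))
    {C : ℝ} (hC : ∀ x : X, ‖featureMap H x‖ ≤ C)
    (hf : MemLp (fun z : X × ℝ => z.2) 2 ρ) : Integrable (pointMoments H) ρ := by
  have hbound : Integrable (fun z : X × ℝ => z.2 ^ 2 + ‖z.2‖ * C + C * C) ρ :=
    (hf.integrable_sq.add ((hf.integrable one_le_two).norm.mul_const C)).add (integrable_const _)
  refine hbound.mono' hmeas.aestronglyMeasurable (ae_of_all _ fun z => ?_)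
  have hC0 : 0 ≤ C := (norm_nonneg _).trans (hC z.1)
  have h1 : ‖z.2 ^ 2‖ = z.2 ^ 2 := by simp
  have h2 : ‖z.2 • featureMap H z.1‖ ≤ ‖z.2‖ * C := by
    rw [norm_smul]
    gcongr
    exact hC z.1
  have h3 : ‖InnerProductSpace.rankOne ℝ (featureMap H z.1) (featureMap H z.1)‖ ≤ C * C := by
    rw [InnerProductSpace.norm_rankOne]
    gcongr <;> exact hC z.1
  have p1 : 0 ≤ z.2 ^ 2 := by positivity
  have p2 : 0 ≤ ‖z.2‖ * C := by positivity
  have p3 : 0 ≤ C * C := by positivity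
  rw [pointMoments, Prod.norm_mk, Prod.norm_mk]
  refine max_le ?_ (max_le ?_ ?_) <;> linarith

end Data

/-! ### Laws of large numbers and passage to `Lᵖ` -/

section LawOfLargeNumbers

variable {α : Type*} [MeasurableSpace α] {ρ : Measure α}
  {Ω : Type*} [MeasurableSpace Ω] {μ : Measure Ω} {Z : ℕ → Ω → α}
  {E : Type*} [NormedAddCommGroup E] [NormedSpace ℝ E] [CompleteSpace E] {ψ : α → E}

theorem strong_law_ae_of_hasLaw (hZ_law : ∀ i, HasLaw (Z i) ρ μ) (hZ_indep : iIndepFun Z μ)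
    (hψ : StronglyMeasurable ψ) (hint : Integrable ψ ρ) :
    ∀ᵐ ω ∂μ, Tendsto (fun n : ℕ => (n : ℝ)⁻¹ • ∑ i ∈ Finset.range n, ψ (Z i ω)) atTop
      (𝓝 (∫ z, ψ z ∂ρ)) := by
  borelize E
  have hint0 : Integrable (ψ ∘ Z 0) μ :=
    (integrable_map_measure (by rw [(hZ_law 0).map_eq]; exact hψ.aestronglyMeasurable)
      (hZ_law 0).aemeasurable).1 (by rwa [(hZ_law 0).map_eq])
  have hident : ∀ i, IdentDistrib (ψ ∘ Z i) (ψ ∘ Z 0) μ μ := fun i =>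
    ((hZ_law i).identDistrib (hZ_law 0)).comp hψ.measurable
  have hind : Pairwise (Function.onFun (IndepFun · · μ) fun i => ψ ∘ Z i) := fun i j hij =>
    (hZ_indep.indepFun hij).comp hψ.measurable hψ.measurable
  have h := strong_law_ae (fun i => ψ ∘ Z i) hint0 hind hident
  rwa [(hZ_law 0).integral_comp hψ.aestronglyMeasurable] at h

theorem strong_law_Lp_of_hasLaw (hZ_law : ∀ i, HasLaw (Z i) ρ μ) (hZ_indep : iIndepFun Z μ)
    {p : ENNReal} (hp : 1 ≤ p) (hp' : p ≠ ⊤) (hψ : StronglyMeasurable ψ) (hLp : MemLp ψ p ρ) :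
    (∀ n : ℕ, MemLp (fun ω => (n : ℝ)⁻¹ • ∑ i ∈ Finset.range n, ψ (Z i ω)) p μ) ∧
    Tendsto (fun n : ℕ => eLpNorm
      (fun ω => (n : ℝ)⁻¹ • (∑ i ∈ Finset.range n, ψ (Z i ω)) - ∫ z, ψ z ∂ρ) p μ) atTop
      (𝓝 0) := by
  borelize E
  have hmem : ∀ i, MemLp (ψ ∘ Z i) p μ := fun i =>
    MemLp.comp_of_map (by rwa [(hZ_law i).map_eq]) (hZ_law i).aemeasurable
  have hident : ∀ i, IdentDistrib (ψ ∘ Z i) (ψ ∘ Z 0) μ μ := fun i =>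
    ((hZ_law i).identDistrib (hZ_law 0)).comp hψ.measurable
  have hind : Pairwise (Function.onFun (IndepFun · · μ) fun i => ψ ∘ Z i) := fun i j hij =>
    (hZ_indep.indepFun hij).comp hψ.measurable hψ.measurable
  have h := strong_law_Lp hp hp' (fun i => ψ ∘ Z i) (hmem 0) hind hident
  rw [(hZ_law 0).integral_comp hψ.aestronglyMeasurable] at h
  exact ⟨fun n => (memLp_finsetSum _ fun i _ => hmem i).const_smul _, h⟩

end LawOfLargeNumbers

/-- Almost everywhere convergence together with domination by an `Lᵖ`-convergent sequence implies
convergence in `Lᵖ`. -/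
theorem tendsto_eLpNorm_of_tendsto_ae_of_norm_le {Ω : Type*} [MeasurableSpace Ω] {μ : Measure Ω}
    [IsFiniteMeasure μ] {p : ENNReal} (hp : 1 ≤ p) (hp' : p ≠ ⊤) {f m : ℕ → Ω → ℝ} {g h : Ω → ℝ}
    (hf : ∀ n, AEStronglyMeasurable (f n) μ) (hg : MemLp g p μ)
    (hm : ∀ n, MemLp (m n) p μ) (hh : MemLp h p μ)
    (hmh : Tendsto (fun n => eLpNorm (m n - h) p μ) atTop (𝓝 0))
    (hfm : ∀ n ω, ‖f n ω‖ ≤ ‖m n ω‖)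
    (hfg : ∀ᵐ ω ∂μ, Tendsto (fun n => f n ω) atTop (𝓝 (g ω))) :
    Tendsto (fun n => eLpNorm (f n - g) p μ) atTop (𝓝 0) := by
  -- Vitali's theorem: `f` inherits uniform integrability from `m`, with the same `δ`.
  refine tendsto_Lp_finite_of_tendsto_ae hp hp' hf hg (fun ε hε => ?_) hfg
  obtain ⟨δ, hδ, hδm⟩ := unifIntegrable_of_tendsto_Lp hp hp' hm hh hmh hε
  refine ⟨δ, hδ, fun n s hs hμs => (eLpNorm_mono fun ω => ?_).trans (hδm n s hs hμs)⟩
  simp only [norm_indicator_eq_indicator_norm]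
  exact Set.indicator_le_indicator (hfm n ω)

/-- `Lᵖ`-consistency of the sample average approximation. -/
theorem tendsto_eLpNorm_saaValue_sub_optimalValue
    {X : Type*} [TopologicalSpace X] [TopologicalSpace.SeparableSpace X]
    [MeasurableSpace X] [OpensMeasurableSpace X] {k : X → X → ℝ}
    (hk_cont : Continuous fun p : X × X => k p.1 p.2)
    (hk_bdd : ∃ C : ℝ, ∀ x y, |k x y| ≤ C)
    {H : Type*} [NormedAddCommGroup H] [InnerProductSpace ℝ H] [CompleteSpace H]
    [RKHS ℝ H X ℝ] (hH : ∀ x y, RKHS.kernel H x y 1 = k x y)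
    {ρ : Measure (X × ℝ)} [IsProbabilityMeasure ρ]
    (hf : MemLp (fun z : X × ℝ => z.2) 2 ρ)
    {Ω : Type*} [MeasurableSpace Ω] {μ : Measure Ω} [IsProbabilityMeasure μ]
    {Z : ℕ → Ω → X × ℝ} (hZ_law : ∀ i, HasLaw (Z i) ρ μ) (hZ_indep : iIndepFun Z μ)
    {lam : ℝ} (hlam : 0 < lam) {p : ENNReal} (hp : 1 ≤ p) (hp' : p ≠ ⊤)
    (hfp : MemLp (fun z : X × ℝ => z.2 ^ 2) p ρ) :
    (∀ n, MemLp (fun ω => saaValue H n (fun i => Z i ω) lam) p μ) ∧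
    Tendsto (fun n : ℕ => eLpNorm
      (fun ω => saaValue H n (fun i => Z i ω) lam - optimalValue H ρ lam) p μ) atTop (𝓝 0) := by
  have hsm := stronglyMeasurable_pointMoments H (continuous_featureMap H hk_cont hH)
  obtain ⟨C, hC⟩ := exists_norm_featureMap_le H hk_bdd hH
  have hint := integrable_pointMoments H hsm hC hf
  obtain ⟨hm, hmlim⟩ := strong_law_Lp_of_hasLaw hZ_law hZ_indep hp hp'
    (measurable_snd.pow_const 2).stronglyMeasurable hfp
  have hmeas : ∀ n, AEStronglyMeasurable (fun ω => saaValue H n (fun i => Z i ω) lam) μ := by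
    intro n
    simp only [saaValue_eq]
    refine aestronglyMeasurable_iInf_momentObjective hlam
      (fun ω g => momentLoss_empiricalMoments_nonneg n _ g) ?_
    have hsum : AEStronglyMeasurable
        (fun ω => ∑ i ∈ Finset.range n, pointMoments H (Z i ω)) μ := by
      refine Finset.aestronglyMeasurable_fun_sum _ fun i _ => ?_
      exact hsm.aestronglyMeasurable.comp_aemeasurable (hZ_law i).aemeasurable
    exact hsum.const_smul (n : ℝ)⁻¹
  have hle : ∀ (n : ℕ) ω, ‖saaValue H n (fun i => Z i ω) lam‖ ≤
      ‖(n : ℝ)⁻¹ • ∑ i ∈ Finset.range n, (Z i ω).2 ^ 2‖ := by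
    intro n ω
    rw [saaValue_eq, ← empiricalMoments_fst H n fun i => Z i ω, Real.norm_of_nonneg
      (iInf_momentObjective_nonneg hlam.le (momentLoss_empiricalMoments_nonneg n _))]
    exact (iInf_momentObjective_le hlam.le (momentLoss_empiricalMoments_nonneg n _)).trans
      (le_abs_self _)
  refine ⟨fun n => (hm n).mono (hmeas n) (ae_of_all _ (hle n)), ?_⟩
  -- The dominating sequence is the empirical mean of `f²`, with `Lᵖ` limit its expectation.
  refine tendsto_eLpNorm_of_tendsto_ae_of_norm_le hp hp' hmeas
    (memLp_const (optimalValue H ρ lam)) hm (memLp_const _) hmlim hle ?_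
  filter_upwards [strong_law_ae_of_hasLaw hZ_law hZ_indep hsm hint] with ω hω
  simp only [saaValue_eq, optimalValue_eq H hint]
  refine tendsto_iInf_momentObjective hlam
    (fun n g => momentLoss_empiricalMoments_nonneg n _ g) (fun g => ?_) hω
  rw [momentLoss_integral_pointMoments hint]
  positivity

end

theorem mainTheorem10
    {X : Type*} [TopologicalSpace X] [TopologicalSpace.SeparableSpace X]
    [MeasurableSpace X] [OpensMeasurableSpace X]
    -- the kernel, continuous and uniformly bounded
    (k : X → X → ℝ)
    (hk_cont : Continuous fun p : X × X => k p.1 p.2)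
    (hk_bdd : ∃ C : ℝ, ∀ x y, |k x y| ≤ C)
    -- its reproducing kernel Hilbert space
    {H : Type*} [NormedAddCommGroup H] [InnerProductSpace ℝ H] [CompleteSpace H]
    [RKHS ℝ H X ℝ]
    (hH : ∀ x y, RKHS.kernel H x y 1 = k x y)
    -- the joint law of `(X, f)`, with `f` square integrable
    (ρ : Measure (X × ℝ)) [IsProbabilityMeasure ρ]
    (hf : MemLp (fun z : X × ℝ => z.2) 2 ρ)
    -- the independent samples `Z i = (X i, f i)` with law `ρ`
    {Ω : Type*} [MeasurableSpace Ω] (μ : Measure Ω) [IsProbabilityMeasure μ]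
    (Z : ℕ → Ω → X × ℝ)
    (hZ_law : ∀ i, HasLaw (Z i) ρ μ)
    (hZ_indep : iIndepFun Z μ)
    -- the regression parameter
    (lam : ℝ) (hlam : 0 < lam) :
    ((∀ n, Integrable (fun ω => saaValue H n (fun i => Z i ω) lam) μ) ∧
      Tendsto (fun n : ℕ =>
          ∫ ω, |saaValue H n (fun i => Z i ω) lam - optimalValue H ρ lam| ∂μ)
        atTop (𝓝 0)) ∧
    (MemLp (fun z : X × ℝ => z.2) 4 ρ →
      (∀ n, MemLp (fun ω => saaValue H n (fun i => Z i ω) lam) 2 μ) ∧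
      Tendsto (fun n : ℕ =>
          ∫ ω, (saaValue H n (fun i => Z i ω) lam - optimalValue H ρ lam) ^ 2 ∂μ)
        atTop (𝓝 0)) := by
  refine ⟨?_, fun hf4 => ?_⟩
  · have hsq : MemLp (fun z : X × ℝ => z.2 ^ 2) 1 ρ := memLp_one_iff_integrable.2 hf.integrable_sq
    obtain ⟨hmem, hlim⟩ := tendsto_eLpNorm_saaValue_sub_optimalValue hk_cont hk_bdd hH hf hZ_law
      hZ_indep hlam le_rfl ENNReal.one_ne_top hsq
    refine ⟨fun n => memLp_one_iff_integrable.1 (hmem n), ?_⟩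
    have h := (ENNReal.tendsto_toReal ENNReal.zero_ne_top).comp hlim
    refine h.congr fun n => ?_
    have hd : Integrable
        (fun ω => saaValue H n (fun i => Z i ω) lam - optimalValue H ρ lam) μ :=
      (memLp_one_iff_integrable.1 (hmem n)).sub (integrable_const _)
    rw [Function.comp_apply, eLpNorm_one_eq_lintegral_enorm,
      ← integral_norm_eq_lintegral_enorm hd.aestronglyMeasurable]
    rfl
  · have hsq : MemLp (fun z : X × ℝ => z.2 ^ 2) 2 ρ := by
      -- The fourth moment serves only to put `f²` in `L²`.
      have h := hf4.norm_rpow_div 2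
      rw [show (4 : ENNReal) / 2 = 2 by
        rw [show (4 : ENNReal) = 2 * 2 by norm_num]
        exact ENNReal.mul_div_cancel_right two_ne_zero ENNReal.ofNat_ne_top] at h
      simpa using h
    obtain ⟨hmem, hlim⟩ := tendsto_eLpNorm_saaValue_sub_optimalValue hk_cont hk_bdd hH hf hZ_law
      hZ_indep hlam one_le_two ENNReal.ofNat_ne_top hsq
    refine ⟨hmem, ?_⟩
    -- The `L²` norm is the root of the mean squared error, hence the square.
    have h := ((ENNReal.tendsto_toReal ENNReal.zero_ne_top).comp hlim).pow 2
    simp only [ENNReal.toReal_zero, ne_eq, OfNat.ofNat_ne_zero, not_false_eq_true, zero_pow] at h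
    refine h.congr fun n => ?_
    have hd : MemLp (fun ω => saaValue H n (fun i => Z i ω) lam - optimalValue H ρ lam) 2 μ :=
      (hmem n).sub (memLp_const _)
    rw [Function.comp_apply, hd.eLpNorm_eq_integral_rpow_norm two_ne_zero ENNReal.ofNat_ne_top,
      ENNReal.toReal_ofReal (by positivity), ENNReal.toReal_ofNat, ← Real.rpow_natCast,
      ← Real.rpow_mul (integral_nonneg fun ω => by positivity)]
    simp
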